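/- Let $a_{02},a_{20}$ be real numbers with $a_{02}>0$ (second order coefficients of the normal form $(u,v)\mapsto\bigl(u,\;uv+\cdots,\;\tfrac12a_{20}u^2+a_{11}uv+\tfrac12a_{02}v^2+\cdots\bigr)$ of a Whitney umbrella). For $\theta\in\mathbb R$ put $$F_k(\theta)=(4a_{02}+a_{20})\cos^4\theta+(a_{02}-a_{20})\cos^2\theta\,\sin^2\theta+(a_{02}+2a_{20})\sin^4\theta ,$$ and let $T=-(3a_{02}+7a_{20})(5a_{02}+a_{20})$. Where $\sin\theta\neq0$, put $s=\cos\theta/\sin\theta$; then $F_k(\theta)=\sin^4\theta\;p(s)$ with $p(s)=(4a_{02}+a_{20})s^4+(a_{02}-a_{20})s^2+(a_{02}+2a_{20})$. Assume $a_{02}\neq a_{20}$ and $4a_{02}+a_{20}\neq0$. Then every real root $\theta$ of $F_k(\theta)=0$ satisfies $\sin\theta\ne 0$, and the real roots are exactly the $\theta$ with - $s=\pm\sqrt{\dfrac{a_{20}-a_{02}+\sqrt T}{2(4a_{02}+a_{20})}}$ if $-4a_{02}<a_{20}<-\tfrac12a_{02}$; - $s=\pm\sqrt{\dfrac{a_{20}-a_{02}\pm\sqrt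 T}{2(4a_{02}+a_{20})}}$ (all four choices of signs) if $-5a_{02}\le a_{20}<-4a_{02}$; - $s=0$, which is a double root of $p$, if $a_{20}=-\tfrac12a_{02}$; and there is no real root otherwise. In the first two cases $T\ge 0$ and the quantities under the outer square roots are positive. Moreover, if $4a_{02}+a_{20}=0$, then the real roots of $F_k(\theta)=0$ with $\sin\theta\neq0$ are exactly $\theta=\pm\cot^{-1}\bigl(\sqrt{7/5}\bigr)$ up to integer multiples of $\pi$. -/

import Mathlib

open Polynomial

/-- The function `F_k(θ)` attached to the second order coefficients `a₀₂`, `a₂₀` of the normal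
form `(u, v) ↦ (u, u v + ⋯, a₂₀ u² / 2 + a₁₁ u v + a₀₂ v² / 2 + ⋯)` of a Whitney umbrella. -/
noncomputable def Fk (a02 a20 θ : ℝ) : ℝ :=
  (4 * a02 + a20) * Real.cos θ ^ 4
    + (a02 - a20) * Real.cos θ ^ 2 * Real.sin θ ^ 2
    + (a02 + 2 * a20) * Real.sin θ ^ 4

/-- The polynomial in `s = cos θ / sin θ` obtained from `F_k(θ)` by dividing by `sin⁴ θ`. -/
noncomputable def pk (a02 a20 : ℝ) : ℝ[X] :=
  C (4 * a02 + a20) * X ^ 4 + C (a02 - a20) * X ^ 2 + C (a02 + 2 * a20)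

/-- The quantity `T`, the discriminant of `F_k` as a quadratic in `s²`. -/
def Tk (a02 a20 : ℝ) : ℝ := -(3 * a02 + 7 * a20) * (5 * a02 + a20)

/-- The inverse cotangent with values in `(0, π)`. -/
noncomputable def arccot (x : ℝ) : ℝ := Real.pi / 2 - Real.arctan x

/-! With `t = s²` the equation becomes `A t² + B t + C = 0`, where `A = 4 a02 + a20`, `B = a02 -
a20`, `C = a02 + 2 a20`; real angles correspond to its roots `t ≥ 0`. Its discriminant is `T = B² -
4 A C`, so the sign of `A C` decides whether `√T` exceeds `|B|`, hence the signs of the two roots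
given by `Fk_eq_zero_iff_sq_eq`. `Fk_ne_zero` covers the ranges without real roots. When `A = 0` the
equation is linear in `t`. -/

theorem Fk_eq_sin_pow_mul_eval (a02 a20 θ : ℝ) (h : Real.sin θ ≠ 0) :
    Fk a02 a20 θ = Real.sin θ ^ 4 * (pk a02 a20).eval (Real.cos θ / Real.sin θ) := by
  simp only [Fk, pk, eval_add, eval_mul, eval_pow, eval_C, eval_X]
  field_simp

/-- If the leading coefficient of `pk` does not vanish, the roots of `F_k` are the angles whose
cotangent is a root of `pk`. -/
theorem Fk_eq_zero_iff {a02 a20 : ℝ} (hA : 4 * a02 + a20 ≠ 0) (θ : ℝ) :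
    Fk a02 a20 θ = 0 ↔ Real.sin θ ≠ 0 ∧
      (4 * a02 + a20) * ((Real.cos θ / Real.sin θ) ^ 2 * (Real.cos θ / Real.sin θ) ^ 2)
        + (a02 - a20) * (Real.cos θ / Real.sin θ) ^ 2 + (a02 + 2 * a20) = 0 := by
  by_cases hs : Real.sin θ = 0
  -- Where the sine vanishes only the term `A cos⁴ θ` survives, and it is nonzero.
  · have hc : Real.cos θ ≠ 0 := by
      intro hc
      have := Real.sin_sq_add_cos_sq θ
      simp [hs, hc] at this
    simp [Fk, hs, hA, hc]
  · rw [Fk_eq_sin_pow_mul_eval a02 a20 θ hs, mul_eq_zero_iff_left (pow_ne_zero 4 hs)]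
    simp only [pk, eval_add, eval_mul, eval_pow, eval_C, eval_X, ne_eq, hs, not_false_eq_true,
      true_and]
    rw [← pow_add]

theorem sq_eq_iff_eq_sqrt {s t : ℝ} (ht : 0 ≤ t) : s ^ 2 = t ↔ s = √t ∨ s = -√t := by
  rw [← sq_eq_sq_iff_eq_or_eq_neg, Real.sq_sqrt ht]

theorem Tk_eq_discrim (a02 a20 : ℝ) :
    Tk a02 a20 = discrim (4 * a02 + a20) (a02 - a20) (a02 + 2 * a20) := by
  simp only [Tk, discrim]
  ring

theorem Fk_eq_zero_iff_sq_eq {a02 a20 : ℝ} (hA : 4 * a02 + a20 ≠ 0) (hT : 0 ≤ Tk a02 a20)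
    (θ : ℝ) :
    Fk a02 a20 θ = 0 ↔ Real.sin θ ≠ 0 ∧
      ((Real.cos θ / Real.sin θ) ^ 2 = (a20 - a02 + √(Tk a02 a20)) / (2 * (4 * a02 + a20)) ∨
        (Real.cos θ / Real.sin θ) ^ 2 = (a20 - a02 - √(Tk a02 a20)) / (2 * (4 * a02 + a20))) := by
  have h : discrim (4 * a02 + a20) (a02 - a20) (a02 + 2 * a20) = √(Tk a02 a20) * √(Tk a02 a20) := by
    rw [Real.mul_self_sqrt hT, Tk_eq_discrim]
  rw [Fk_eq_zero_iff hA, quadratic_eq_zero_iff hA h, neg_sub]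

theorem pk_rootMultiplicity_zero {a02 a20 : ℝ} (hc : a02 + 2 * a20 = 0) (hb : a02 ≠ a20) :
    (pk a02 a20).rootMultiplicity 0 = 2 := by
  have hfac : pk a02 a20 =
      (C (4 * a02 + a20) * X ^ 2 + C (a02 - a20)) * (X - C 0) ^ 2 := by
    simp only [pk, hc, map_zero]
    ring
  have hne : (C (4 * a02 + a20) * X ^ 2 + C (a02 - a20) : ℝ[X]).eval 0 ≠ 0 := by
    simpa [sub_eq_zero] using hb
  rw [hfac, rootMultiplicity_mul_X_sub_C_pow (fun h => hne (by rw [h, eval_zero])),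
    rootMultiplicity_eq_zero hne]

theorem sin_arccot_pos (x : ℝ) : 0 < Real.sin (arccot x) := by
  rw [arccot, Real.sin_pi_div_two_sub]
  exact Real.cos_arctan_pos x

theorem cos_arccot (x : ℝ) : Real.cos (arccot x) = x * Real.sin (arccot x) := by
  rw [arccot, Real.sin_pi_div_two_sub, Real.cos_pi_div_two_sub, Real.sin_arctan, Real.cos_arctan]
  ring

/-- Up to a nonzero factor, `x sin θ - cos θ` is `sin (θ - arccot x)`, whose zeros are the multiples
of `π` in `θ - arccot x`. -/
theorem cot_eq_iff_exists_arccot {θ : ℝ} (hs : Real.sin θ ≠ 0) (x : ℝ) :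
    Real.cos θ / Real.sin θ = x ↔ ∃ n : ℤ, θ = arccot x + n * Real.pi := by
  have key : Real.sin (θ - arccot x) =
      Real.sin (arccot x) * (x * Real.sin θ - Real.cos θ) := by
    rw [Real.sin_sub, cos_arccot]
    ring
  rw [div_eq_iff hs, eq_comm, ← sub_eq_zero, ← mul_eq_zero_iff_left (sin_arccot_pos x).ne', ← key,
    Real.sin_eq_zero_iff]
  exact exists_congr fun n => by rw [eq_sub_iff_add_eq', eq_comm]

theorem cot_eq_neg_iff_exists_arccot {θ : ℝ} (hs : Real.sin θ ≠ 0) (x : ℝ) :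
    Real.cos θ / Real.sin θ = -x ↔ ∃ n : ℤ, θ = -arccot x + n * Real.pi := by
  have key : Real.sin (θ + arccot x) =
      Real.sin (arccot x) * (Real.cos θ - -x * Real.sin θ) := by
    rw [Real.sin_add, cos_arccot]
    ring
  rw [div_eq_iff hs, ← sub_eq_zero, ← mul_eq_zero_iff_left (sin_arccot_pos x).ne', ← key,
    Real.sin_eq_zero_iff]
  exact exists_congr fun n => by rw [eq_neg_add_iff_add_eq, add_comm, eq_comm]

/-- Either `T < 0`, or `-a02 / 2 < a20 ≤ -3 a02 / 7`, where `A`, `B`, `C` are all positive and no `t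
≥ 0` is a root. -/
theorem Fk_ne_zero {a02 a20 : ℝ} (ha02 : 0 < a02) (hA : 4 * a02 + a20 ≠ 0)
    (h : a20 < -5 * a02 ∨ -(1 / 2) * a02 < a20) (θ : ℝ) : Fk a02 a20 θ ≠ 0 := by
  rw [Ne, Fk_eq_zero_iff hA]
  rintro ⟨-, h0⟩
  by_cases hT : Tk a02 a20 < 0
  · rw [Tk_eq_discrim] at hT
    exact quadratic_ne_zero_of_discrim_ne_sq (fun r hr => by nlinarith [sq_nonneg r]) _ h0
  · have hlow : -(1 / 2) * a02 < a20 := h.resolve_left fun h' => hT <| by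
      rw [Tk]
      nlinarith [mul_pos_of_neg_of_neg (show 3 * a02 + 7 * a20 < 0 by linarith)
        (show 5 * a02 + a20 < 0 by linarith)]
    have hup : 3 * a02 + 7 * a20 ≤ 0 := by
      by_contra! h'
      refine hT ?_
      rw [Tk]
      nlinarith [mul_pos h' (show 0 < 5 * a02 + a20 by linarith)]
    have h1 : 0 < 4 * a02 + a20 := by linarith
    have h2 : 0 < a02 - a20 := by linarith
    have h3 : 0 < a02 + 2 * a20 := by linarith
    have : 0 ≤ (Real.cos θ / Real.sin θ) ^ 2 := sq_nonneg _
    generalize (Real.cos θ / Real.sin θ) ^ 2 = t at *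
    have : 0 < (4 * a02 + a20) * (t * t) + (a02 - a20) * t + (a02 + 2 * a20) := by positivity
    exact this.ne' h0

theorem theorem4 (a02 a20 : ℝ) (ha02 : 0 < a02) :
    -- substituting `s = cos θ / sin θ` turns `F_k(θ) = 0` into the quartic equation `pk(s) = 0`
    (∀ θ : ℝ, Real.sin θ ≠ 0 →
      Fk a02 a20 θ = Real.sin θ ^ 4 * (pk a02 a20).eval (Real.cos θ / Real.sin θ)) ∧
    (a02 ≠ a20 → 4 * a02 + a20 ≠ 0 →
      -- case `-4 a₀₂ < a₂₀ < -a₀₂ / 2`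
      ((-4 * a02 < a20 ∧ a20 < -(1 / 2) * a02) →
        0 ≤ Tk a02 a20 ∧
        0 < (a20 - a02 + √(Tk a02 a20)) / (2 * (4 * a02 + a20)) ∧
        ∀ θ : ℝ, Fk a02 a20 θ = 0 ↔
          Real.sin θ ≠ 0 ∧
          (Real.cos θ / Real.sin θ = √((a20 - a02 + √(Tk a02 a20)) / (2 * (4 * a02 + a20))) ∨
           Real.cos θ / Real.sin θ = -√((a20 - a02 + √(Tk a02 a20)) / (2 * (4 * a02 + a20))))) ∧
      -- case `-5 a₀₂ ≤ a₂₀ < -4 a₀₂`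
      ((-5 * a02 ≤ a20 ∧ a20 < -4 * a02) →
        0 ≤ Tk a02 a20 ∧
        0 < (a20 - a02 + √(Tk a02 a20)) / (2 * (4 * a02 + a20)) ∧
        0 < (a20 - a02 - √(Tk a02 a20)) / (2 * (4 * a02 + a20)) ∧
        ∀ θ : ℝ, Fk a02 a20 θ = 0 ↔
          Real.sin θ ≠ 0 ∧
          (Real.cos θ / Real.sin θ = √((a20 - a02 + √(Tk a02 a20)) / (2 * (4 * a02 + a20))) ∨
           Real.cos θ / Real.sin θ = -√((a20 - a02 + √(Tk a02 a20)) / (2 * (4 * a02 + a20))) ∨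
           Real.cos θ / Real.sin θ = √((a20 - a02 - √(Tk a02 a20)) / (2 * (4 * a02 + a20))) ∨
           Real.cos θ / Real.sin θ = -√((a20 - a02 - √(Tk a02 a20)) / (2 * (4 * a02 + a20))))) ∧
      -- case `a₂₀ = -a₀₂ / 2`: the only real root is `s = 0`, and it is a double root
      (a20 = -(1 / 2) * a02 →
        (∀ θ : ℝ, Fk a02 a20 θ = 0 ↔ Real.sin θ ≠ 0 ∧ Real.cos θ / Real.sin θ = 0) ∧
        (pk a02 a20).rootMultiplicity 0 = 2) ∧
      -- otherwise: no real root
      (¬ (-4 * a02 < a20 ∧ a20 < -(1 / 2) * a02) →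
        ¬ (-5 * a02 ≤ a20 ∧ a20 < -4 * a02) →
        a20 ≠ -(1 / 2) * a02 →
        ∀ θ : ℝ, Fk a02 a20 θ ≠ 0)) ∧
    (4 * a02 + a20 = 0 →
      -- roots in the domain `sin θ ≠ 0` of `s`; `F_k` has period `π`
      ∀ θ : ℝ, Real.sin θ ≠ 0 →
        (Fk a02 a20 θ = 0 ↔
          ∃ n : ℤ, θ = arccot (√(7 / 5)) + n * Real.pi ∨
            θ = -arccot (√(7 / 5)) + n * Real.pi)) := by
  refine ⟨fun θ => Fk_eq_sin_pow_mul_eval a02 a20 θ, fun hne hA => ⟨?_, ?_, ?_, ?_⟩, ?_⟩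
  · rintro ⟨hlow, hup⟩
    have hApos : 0 < 4 * a02 + a20 := by linarith
    -- Here `T - B² = -4 A C > 0`: the roots in `t` have opposite signs.
    have hlt : (a02 - a20) ^ 2 < Tk a02 a20 := by
      rw [Tk]
      nlinarith [mul_pos hApos (show 0 < -(a02 + 2 * a20) by linarith)]
    have hT : 0 ≤ Tk a02 a20 := (sq_nonneg _).trans hlt.le
    have hsqrt : a02 - a20 < √(Tk a02 a20) := Real.lt_sqrt_of_sq_lt hlt
    have hplus : 0 < (a20 - a02 + √(Tk a02 a20)) / (2 * (4 * a02 + a20)) :=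
      div_pos (by linarith) (by linarith)
    have hminus : (a20 - a02 - √(Tk a02 a20)) / (2 * (4 * a02 + a20)) < 0 :=
      div_neg_of_neg_of_pos (by linarith) (by linarith)
    refine ⟨hT, hplus, fun θ => ?_⟩
    rw [Fk_eq_zero_iff_sq_eq hA hT, sq_eq_iff_eq_sqrt hplus.le,
      or_iff_left (hminus.trans_le (sq_nonneg _)).ne']
  · rintro ⟨hlow, hup⟩
    have hAneg : 4 * a02 + a20 < 0 := by linarith
    have hT : 0 ≤ Tk a02 a20 :=
      mul_nonneg (by linarith) (by linarith)
    -- Now `A` and `C` are both negative, so `√T < B`; both numerators are negative, as is the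
    -- denominator.
    have hlt : Tk a02 a20 < (a02 - a20) ^ 2 := by
      rw [Tk]
      nlinarith [mul_pos_of_neg_of_neg hAneg (show a02 + 2 * a20 < 0 by linarith)]
    have hsqrt : √(Tk a02 a20) < a02 - a20 := (Real.sqrt_lt' (by linarith)).2 hlt
    have hplus : 0 < (a20 - a02 + √(Tk a02 a20)) / (2 * (4 * a02 + a20)) :=
      div_pos_of_neg_of_neg (by linarith) (by linarith)
    have hminus : 0 < (a20 - a02 - √(Tk a02 a20)) / (2 * (4 * a02 + a20)) :=
      div_pos_of_neg_of_neg (by linarith [Real.sqrt_nonneg (Tk a02 a20)]) (by linarith)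
    refine ⟨hT, hplus, hminus, fun θ => ?_⟩
    rw [Fk_eq_zero_iff_sq_eq hA hT, sq_eq_iff_eq_sqrt hplus.le, sq_eq_iff_eq_sqrt hminus.le,
      or_assoc]
  · intro heq
    have hc : a02 + 2 * a20 = 0 := by linarith
    refine ⟨fun θ => ?_, pk_rootMultiplicity_zero hc hne⟩
    rw [Fk_eq_zero_iff hA, hc]
    refine and_congr_right fun _ => ⟨fun h => ?_, fun h => by simp [h]⟩
    have hpos : 0 < (4 * a02 + a20) * (Real.cos θ / Real.sin θ) ^ 2 + (a02 - a20) :=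
      add_pos_of_nonneg_of_pos (mul_nonneg (by linarith) (sq_nonneg _)) (by linarith)
    have h' : ((4 * a02 + a20) * (Real.cos θ / Real.sin θ) ^ 2 + (a02 - a20)) *
        (Real.cos θ / Real.sin θ) ^ 2 = 0 := by
      rw [← h]
      ring
    exact pow_eq_zero_iff two_ne_zero |>.1 ((mul_eq_zero_iff_left hpos.ne').1 h')
  · intro h1 h2 h3
    refine Fk_ne_zero ha02 hA ?_
    -- What remains is `-5 a02 ≤ a20 ≤ -a02 / 2`, which the three excluded cases cover except for `A
    -- = 0`.
    by_contra! h
    have hlt : a20 < -(1 / 2) * a02 := lt_of_le_of_ne h.2 h3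
    have h4 : a20 ≤ -4 * a02 := not_lt.1 fun h' => h1 ⟨h', hlt⟩
    exact h2 ⟨h.1, lt_of_le_of_ne h4 fun h' => hA (by linarith)⟩
  · intro hA θ hs
    obtain rfl : a20 = -4 * a02 := by linarith
    rw [exists_or, ← cot_eq_iff_exists_arccot hs, ← cot_eq_neg_iff_exists_arccot hs,
      ← sq_eq_iff_eq_sqrt (by norm_num), Fk_eq_sin_pow_mul_eval _ _ _ hs,
      mul_eq_zero_iff_left (pow_ne_zero 4 hs)]
    simp only [pk, eval_add, eval_mul, eval_pow, eval_C, eval_X]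
    generalize (Real.cos θ / Real.sin θ) = s
    have : (4 * a02 + -4 * a02) * s ^ 4 + (a02 - -4 * a02) * s ^ 2 + (a02 + 2 * (-4 * a02)) =
        5 * a02 * (s ^ 2 - 7 / 5) := by ring
    rw [this, mul_eq_zero_iff_left (by positivity), sub_eq_zero]
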